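/- A \emph{garden-hose game} of size $s$ for $n$-bit inputs is given as follows. Let $A_\circ=\{0,1^A,\dots,s^A\}$ and $B=\{1^B,\dots,s^B\}$ be disjoint vertex sets ($0$ is the water tap on Alice's side), and let $E=\{\{i^A,i^B\} : 1\le i\le s\}$ be the set of pipes. For every $x\in\{0,1\}^n$ there is a set $E_{A_\circ}(x)$ of edges (without self-loops) on $A_\circ$, and for every $y\in\{0,1\}^n$ a set $E_B(y)$ of edges (without self-loops) on $B$, such that the graphs $(A_\circ,E_{A_\circ}(x))$ and $(B,E_B(y))$ have maximum degree at most $1$. The game \emph{computes} $f:\{0,1\}^n\times\{0,1\}^n\to\{0,1\}$ if, for all $x,y$, the endpoint of the (unique) maximal path starting at $0$ in the graph $(A_\circ\cup B,\;E\cup E_{A_\circ}(x)\cup E_B(y))$ lies in $A_\circ$ when $f(x,y)=0$ and in $B$ when $f(x,y)=1$. The \emph{garden-hose complexity} $\mathrm{gh}(f)$ is the smallest size of a garden-hose game that computes $f$. A family $f=(f_n)_{n\in\mathbb N}$ of functions $f_n:\{0,1\}^n\times\{0,1\}^n\to\{0,1\}$ is \emph{log-space computable} if there are a deterministic Turing machine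 $M$ with a read-only input tape (with end markers) and finitely many work tapes, and a constant $c$, such that for all $n\ge 1$ and all $x,y\in\{0,1\}^n$, the machine $M$, started with the $2n$-bit word $xy$ on its input tape, halts with output $f_n(x,y)$, and its heads visit at most $c\cdot\log_2(2n)$ locations of the work tapes during this computation. \textbf{Theorem.} If $f=(f_n)_{n\in\mathbb N}$ is log-space computable, then $\mathrm{gh}(f_n)$ is polynomial in $n$: there is a polynomial $p$ with coefficients in $\mathbb N$ such that $\mathrm{gh}(f_n)\le p(n)$ for every $n$. -/

import Mathlib

/-! ### The garden-hose game -/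

/-- A garden-hose game for `n`-bit inputs with `size` pipes. Alice's ends of the pipes, together
with the water tap, are the vertices `Option (Fin size)` (`none` is the tap, `some i` is Alice's end
of pipe `i`); Bob's ends are the vertices `Fin size`. Each player chooses, depending only on their
own input, a graph of maximum degree at most one on their own vertices. -/
structure GardenHoseGame (n : ℕ) where
  size : ℕ
  alice : (Fin n → Bool) → SimpleGraph (Option (Fin size))
  bob : (Fin n → Bool) → SimpleGraph (Fin size)
  alice_degree_le_one : ∀ x u v w, (alice x).Adj u v → (alice x).Adj u w → v = w
  bob_degree_le_one : ∀ y u v w, (bob y).Adj u v → (bob y).Adj u w → v = w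

namespace GardenHoseGame

variable {n : ℕ}

/-- The vertices of the game: Alice's side (with the tap) and Bob's side. -/
abbrev Vertex (G : GardenHoseGame n) : Type := Option (Fin G.size) ⊕ Fin G.size

/-- The water tap, on Alice's side. -/
def tap (G : GardenHoseGame n) : G.Vertex := Sum.inl none

/-- Adjacency in `G(x, y)`: the connections of Alice, the connections of Bob, and the pipes. -/
def Adjacent (G : GardenHoseGame n) (x y : Fin n → Bool) : G.Vertex → G.Vertex → Prop
  | Sum.inl u, Sum.inl v => (G.alice x).Adj u v
  | Sum.inr i, Sum.inr j => (G.bob y).Adj i j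
  | Sum.inl u, Sum.inr j => u = some j
  | Sum.inr i, Sum.inl v => v = some i

/-- The graph `G(x, y)`. -/
def graph (G : GardenHoseGame n) (x y : Fin n → Bool) : SimpleGraph G.Vertex where
  Adj := G.Adjacent x y
  symm := ⟨by
    rintro (u | i) (v | j) h
    · exact SimpleGraph.Adj.symm (G := G.alice x) h
    · exact h
    · exact h
    · exact SimpleGraph.Adj.symm (G := G.bob y) h⟩
  loopless := ⟨by
    rintro (u | i) h
    · exact (G.alice x).loopless.irrefl u h
    · exact (G.bob y).loopless.irrefl i h⟩

/-- A path is maximal (among the paths with the same starting point) if it cannot be prolonged at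
its end, i.e. if every neighbour of its endpoint already lies on it. -/
def IsMaximalPath {V : Type} {H : SimpleGraph V} {u v : V} (p : H.Walk u v) : Prop :=
  p.IsPath ∧ ∀ w, H.Adj v w → w ∈ p.support

/-- `v` is the endpoint of the maximal path in `G(x, y)` that starts at the tap: the place where
the water comes out. -/
def WaterExitsAt (G : GardenHoseGame n) (x y : Fin n → Bool) (v : G.Vertex) : Prop :=
  ∃ p : (G.graph x y).Walk G.tap v, IsMaximalPath p

/-- In a graph of maximum degree at most two, a path that arrives from `a` and cannot be prolonged
outside the set `S` of the vertices passed before has only one possible endpoint. -/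
theorem endpoint_unique_aux {V : Type} {H : SimpleGraph V}
    (hH : ∀ u a b c, H.Adj u a → H.Adj u b → H.Adj u c → b ≠ a → c ≠ a → b = c)
    {u v : V} (p : H.Walk u v) : ∀ {w : V} (q : H.Walk u w) (S : Set V) (a : V), a ∈ S →
    H.Adj u a → p.IsPath → q.IsPath → (∀ z ∈ S, z ∉ p.support) → (∀ z ∈ S, z ∉ q.support) →
    (∀ z, H.Adj v z → z ∈ S ∨ z ∈ p.support) → (∀ z, H.Adj w z → z ∈ S ∨ z ∈ q.support) →
    v = w := by
  induction p with
  | nil =>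
    intro w q S a haS ha hp hq hap haq hmp hmq
    cases q with
    | nil => rfl
    | cons h q =>
      rcases hmp _ h with hz | hz
      · exact absurd (by simp) (haq _ hz)
      · simp only [SimpleGraph.Walk.support_nil, List.mem_singleton] at hz
        exact absurd hz h.ne'
  | @cons u u' v h p ih =>
    intro w q S a haS ha hp hq hap haq hmp hmq
    cases q with
    | nil =>
      rcases hmq _ h with hz | hz
      · exact absurd (by simp) (hap _ hz)
      · simp only [SimpleGraph.Walk.support_nil, List.mem_singleton] at hz
        exact absurd hz h.ne'
    | cons h' q =>
      simp only [SimpleGraph.Walk.support_cons, List.mem_cons, not_or] at hap haq hmp hmq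
      obtain rfl := hH _ _ _ _ ha h h' (by rintro rfl; simpa using hap _ haS)
        (by rintro rfl; simpa using haq _ haS)
      rw [SimpleGraph.Walk.cons_isPath_iff] at hp hq
      refine ih q (insert u S) u (Set.mem_insert _ _) h.symm hp.1 hq.1 ?_ ?_ ?_ ?_
      · rintro z (rfl | hz)
        · exact hp.2
        · exact (hap z hz).2
      · rintro z (rfl | hz)
        · exact hq.2
        · exact (haq z hz).2
      · intro z hz
        rcases hmp z hz with h | h | h <;> simp [h]
      · intro z hz
        rcases hmq z hz with h | h | h <;> simp [h]

/-- The endpoint of the maximal path from the tap is unique. -/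
theorem WaterExitsAt.unique {G : GardenHoseGame n} {x y : Fin n → Bool} {v w : G.Vertex}
    (hv : G.WaterExitsAt x y v) (hw : G.WaterExitsAt x y w) : v = w := by
  obtain ⟨p, hp, hmp⟩ := hv
  obtain ⟨q, hq, hmq⟩ := hw
  have htap : ∀ b c, (G.graph x y).Adj G.tap b → (G.graph x y).Adj G.tap c → b = c := by
    rintro (b | b) (c | c) hb hc
    · exact congrArg Sum.inl (G.alice_degree_le_one x _ _ _ hb hc)
    · exact absurd (show (none : Option (Fin G.size)) = some c from hc) (by simp)
    · exact absurd (show (none : Option (Fin G.size)) = some b from hb) (by simp)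
    · exact absurd (show (none : Option (Fin G.size)) = some b from hb) (by simp)
  have hH : ∀ u a b c, (G.graph x y).Adj u a → (G.graph x y).Adj u b → (G.graph x y).Adj u c →
      b ≠ a → c ≠ a → b = c := by
    have hA := G.alice_degree_le_one x
    have hB := G.bob_degree_le_one y
    rintro (u | u) (a | a) (b | b) (c | c) ha hb hc hab hac <;>
      simp only [graph, Adjacent] at ha hb hc <;> grind
  revert p q
  generalize G.tap = t at htap
  intro p hp hmp q hq hmq
  cases p with
  | nil =>
    cases q with
    | nil => rfl
    | cons h q =>
      have := hmp _ h
      simp only [SimpleGraph.Walk.support_nil, List.mem_singleton] at this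
      exact absurd this h.ne'
  | cons h p =>
    cases q with
    | nil =>
      have := hmq _ h
      simp only [SimpleGraph.Walk.support_nil, List.mem_singleton] at this
      exact absurd this h.ne'
    | cons h' q =>
      obtain rfl := htap _ _ h h'
      rw [SimpleGraph.Walk.cons_isPath_iff] at hp hq
      simp only [SimpleGraph.Walk.support_cons, List.mem_cons] at hmp hmq
      exact endpoint_unique_aux hH p q {t} t rfl h.symm hp.1 hq.1
        (by rintro z rfl; exact hp.2) (by rintro z rfl; exact hq.2) hmp hmq

/-- The game computes `f` if the water comes out on Alice's side when `f x y = 0` and on Bob's side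
when `f x y = 1`. -/
def Computes (G : GardenHoseGame n) (f : (Fin n → Bool) → (Fin n → Bool) → Bool) : Prop :=
  ∀ x y, ∃ v, G.WaterExitsAt x y v ∧
    (f x y = false → v.isLeft = true) ∧ (f x y = true → v.isRight = true)

end GardenHoseGame

/-- The garden-hose complexity of `f`: the least number of pipes of a garden-hose game that
computes `f` (it would be `⊤` if there were no such game). -/
noncomputable def gardenHoseComplexity {n : ℕ} (f : (Fin n → Bool) → (Fin n → Bool) → Bool) : ℕ∞ :=
  ⨅ (G : GardenHoseGame n) (_ : G.Computes f), (G.size : ℕ∞)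

/-! ### Deterministic Turing machines with a read-only input tape and work tapes -/

/-- The contents of a cell of the input tape, whose ends are marked. -/
inductive InputSymbol where
  | leftEnd
  | bit (b : Bool)
  | rightEnd

/-- Head movements. -/
inductive HeadMove where
  | left
  | stay
  | right

/-- A deterministic Turing machine with a two-way read-only input tape and `tapes` many two-way
infinite work tapes, with finite state set `State` and finite work alphabet `Symbol`. In one step the
machine reads the scanned input cell and the scanned cell of each work tape, changes its state, moves
the input head, writes on each work tape and moves each work head. -/
structure OfflineTM where
  State : Type
  stateFintype : Fintype State
  Symbol : Type
  symbolFintype : Fintype Symbol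
  blank : Symbol
  tapes : ℕ
  start : State
  accept : State
  reject : State
  accept_ne_reject : accept ≠ reject
  trans : State → InputSymbol → (Fin tapes → Symbol) →
    State × HeadMove × (Fin tapes → Symbol × HeadMove)

namespace OfflineTM

/-- The content of cell `p` of the input tape: cell `0` is the left end marker, cells
`1, …, w.length` hold the input word `w`, and cell `w.length + 1` is the right end marker. -/
def inputSymbol (w : List Bool) : ℕ → InputSymbol
  | 0 => InputSymbol.leftEnd
  | p + 1 =>
    match w[p]? with
    | some b => InputSymbol.bit b
    | none => InputSymbol.rightEnd

/-- Movement of the input head, which never leaves the cells `0, …, N + 1`. -/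
def moveInput (N : ℕ) (p : ℕ) : HeadMove → ℕ
  | HeadMove.left => p - 1
  | HeadMove.stay => p
  | HeadMove.right => min (p + 1) (N + 1)

/-- Movement of a work head. -/
def moveWork (z : ℤ) : HeadMove → ℤ
  | HeadMove.left => z - 1
  | HeadMove.stay => z
  | HeadMove.right => z + 1

/-- A configuration: state, position of the input head, positions of the work heads, contents of
the work tapes. -/
structure Cfg (M : OfflineTM) where
  state : M.State
  inputHead : ℕ
  workHead : Fin M.tapes → ℤ
  work : Fin M.tapes → ℤ → M.Symbol

/-- The starting configuration: blank work tapes, input head on the left end marker. -/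
def init (M : OfflineTM) : M.Cfg where
  state := M.start
  inputHead := 0
  workHead := fun _ => 0
  work := fun _ _ => M.blank

open Classical in
/-- One step of the machine on input `w`. The machine halts when it reaches the accepting or the
rejecting state; a halted configuration is its own successor. -/
noncomputable def step (M : OfflineTM) (w : List Bool) (c : M.Cfg) : M.Cfg :=
  if c.state = M.accept ∨ c.state = M.reject then c
  else
    let r := M.trans c.state (inputSymbol w c.inputHead) (fun i => c.work i (c.workHead i))
    { state := r.1
      inputHead := moveInput w.length c.inputHead r.2.1
      workHead := fun i => moveWork (c.workHead i) (r.2.2 i).2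
      work := fun i => Function.update (c.work i) (c.workHead i) (r.2.2 i).1 }

/-- The configuration after `t` steps on input `w`. -/
noncomputable def run (M : OfflineTM) (w : List Bool) (t : ℕ) : M.Cfg :=
  (M.step w)^[t] M.init

/-- On input `w` the machine halts with output `b`: it accepts for `1` and rejects for `0`. -/
def Outputs (M : OfflineTM) (w : List Bool) (b : Bool) : Prop :=
  ∃ t, (M.run w t).state = if b = true then M.accept else M.reject

/-- The locations of the work tapes visited by the work heads in the computation on input `w`. -/
def visited (M : OfflineTM) (w : List Bool) : Set (Fin M.tapes × ℤ) :=
  {l | ∃ t, (M.run w t).workHead l.1 = l.2}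

end OfflineTM

/-- The family `f`, with one Boolean function of two `n`-bit strings for each `n`, is log-space
computable: a single Turing machine, given the `2 n`-bit word `x y` on its input tape, outputs
`f n x y` and visits at most `c * log (2 n)` locations of its work tapes. Nothing is required for
the empty input word (`n = 0`), where the logarithm makes no sense. -/
def LogSpaceComputable (f : ∀ n : ℕ, (Fin n → Bool) → (Fin n → Bool) → Bool) : Prop :=
  ∃ (M : OfflineTM) (c : ℝ), ∀ n : ℕ, 1 ≤ n → ∀ x y : Fin n → Bool,
    M.Outputs (List.ofFn x ++ List.ofFn y) (f n x y) ∧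
    (M.visited (List.ofFn x ++ List.ofFn y)).Finite ∧
    ((M.visited (List.ofFn x ++ List.ofFn y)).ncard : ℝ) ≤ c * Real.logb 2 (2 * (n : ℝ))

/-!
The configurations that a log-space machine can reach on words of length `2 n` number `n ^ O(1)`,
and each step among them is determined by Alice's input alone or by Bob's, according to the half of
the word that the input head reads. Water cannot simply follow these steps: several configurations
may have the same successor, whereas a pipe end takes at most one hose.

The remedy is the reversible simulation of Lange, McKenzie and Tapp. Draw the step relation as a
graph. The component of a halting configuration is a tree rooted there, and the tour that walks
around it, turning at each vertex to the next edge in a fixed cyclic order, is injective and ends at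
the root. Crossing an edge in either direction is an involution of the corners of the graph; it is
the product of an involution that Alice knows and one that Bob knows. So each step of the tour is a
partial permutation applied by Alice followed by one applied by Bob, which hoses can realize. At the
halting corner the output decides which of the two has no hose, so that the water comes out there.
-/

open Relation

/-! ### Reachability in functional relations -/

section Reachability

variable {V : Type*} {R : V → V → Prop} {a b : V}

theorem reflTransGen_and_ne_source (h : ReflTransGen R a b) :
    ReflTransGen (fun u v => R u v ∧ v ≠ a) a b := by
  suffices ∀ u, ReflTransGen R u b →
      ReflTransGen (fun u v => R u v ∧ v ≠ a) u b ∨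
        ReflTransGen (fun u v => R u v ∧ v ≠ a) a b from
    (this a h).elim id id
  intro u hu
  induction hu using ReflTransGen.head_induction_on with
  | refl => exact .inl .refl
  | @head u v huv _ ih =>
    by_cases hv : v = a
    · subst hv
      exact .inr (ih.elim id id)
    · exact ih.imp_left (.head ⟨huv, hv⟩)

theorem not_transGen_self_of_reflTransGen (hR : Relator.LeftUnique R) (ha : ∀ u, ¬ R u a)
    (hab : ReflTransGen R a b) : ¬ TransGen R b b := by
  induction hab with
  | refl =>
    intro h
    obtain ⟨u, -, hu⟩ := TransGen.tail'_iff.1 h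
    exact ha u hu
  | @tail b c _ hbc ih =>
    intro h
    obtain ⟨u, hcu, huc⟩ := TransGen.tail'_iff.1 h
    obtain rfl : u = b := hR huc hbc
    exact ih (TransGen.head' hbc hcu)

theorem acc_of_reflTransGen [Finite V] (hR : Relator.RightUnique R) (hb : ∀ v, ¬ R b v)
    (hab : ReflTransGen R a b) : Acc R a := by
  let Ancestor (u v : V) : Prop := TransGen R u v ∧ ReflTransGen R v b
  have : IsTrans V Ancestor := ⟨fun _ _ _ huv hvw => ⟨huv.1.trans hvw.1, hvw.2⟩⟩
  have : Std.Irrefl Ancestor := ⟨fun u hu =>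
    not_transGen_self_of_reflTransGen (R := Function.swap R) (fun _ _ _ h h' => hR h h') hb
      (reflTransGen_swap.2 hu.2) (transGen_swap.2 hu.1)⟩
  induction a using (Finite.wellFounded_of_trans_of_irrefl Ancestor).induction with
  | _ v ih => exact .intro v fun u huv => ih u ⟨.single huv, hab⟩ (.head huv hab)

end Reachability

/-! ### Relay games -/

namespace GardenHoseGame

section Graphs

variable {V : Type*} {R : V → V → Prop}

theorem eq_of_fromRel_adj (hl : Relator.LeftUnique R) (hr : Relator.RightUnique R)
    (hR : ∀ u v w, R u v → ¬ R v w) {u v w : V} (huv : (SimpleGraph.fromRel R).Adj u v)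
    (huw : (SimpleGraph.fromRel R).Adj u w) : v = w := by
  rcases huv.2 with huv | hvu <;> rcases huw.2 with huw | hwu
  · exact hr huv huw
  · exact absurd huv (hR _ _ _ hwu)
  · exact absurd huw (hR _ _ _ hvu)
  · exact hl hvu hwu

theorem fromRel_adj_iff (hR : ∀ u, ¬ R u u) {u v : V} :
    (SimpleGraph.fromRel R).Adj u v ↔ R u v ∨ R v u := by
  refine (SimpleGraph.fromRel_adj R u v).trans (and_iff_right_of_imp ?_)
  rintro h rfl
  exact hR u (h.elim id id)

end Graphs

/-- The path follows the orientation `R`: it cannot meet itself, since a vertex met twice would lie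
on a cycle, and the only neighbour of `b` is the vertex from which it is entered. -/
theorem exists_isMaximalPath {V : Type} {R : V → V → Prop} {H : SimpleGraph V}
    (hH : ∀ u v, H.Adj u v ↔ R u v ∨ R v u) (hR : Relator.LeftUnique R) {a b : V}
    (ha : ∀ u, ¬ R u a) (hb : ∀ v, ¬ R b v) (hab : ReflTransGen R a b) :
    ∃ p : H.Walk a b, IsMaximalPath p := by
  suffices ∀ v, ReflTransGen R a v → ∃ p : H.Walk a v, p.IsPath ∧
      (∀ u ∈ p.support, ReflTransGen R u v) ∧ ∀ u, R u v → u ∈ p.support by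
    obtain ⟨p, hp, -, hpred⟩ := this b hab
    exact ⟨p, hp, fun w hw => hpred w (((hH b w).1 hw).resolve_left (hb w))⟩
  intro v hv
  induction hv with
  | refl => exact ⟨.nil, .nil, by simp [ReflTransGen.refl], fun u hu => absurd hu (ha u)⟩
  | @tail v w hav hvw ih =>
    obtain ⟨p, hp, hreach, -⟩ := ih
    have hw : w ∉ p.support := fun hw =>
      not_transGen_self_of_reflTransGen hR ha (hav.tail hvw) (.tail' (hreach w hw) hvw)
    refine ⟨p.concat ((hH v w).2 (.inl hvw)), hp.concat hw _, fun u hu => ?_, fun u hu => ?_⟩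
    · rw [SimpleGraph.Walk.support_concat, List.mem_append, List.mem_singleton] at hu
      rcases hu with hu | rfl
      · exact (hreach u hu).tail hvw
      · exact .refl
    · obtain rfl : u = v := hR hu hvw
      simp

section Relay

variable {C : Type*}

section BobHose

variable {β : C ≃. C}

/-- Bob's hoses in a relay, directed along the water: they lead from position `c` to `β c`. -/
def BobHose (β : C ≃. C) (u v : C ⊕ C) : Prop :=
  ∃ c d, β c = some d ∧ u = .inl c ∧ v = .inr d

theorem BobHose.leftUnique : Relator.LeftUnique (BobHose β) := by
  rintro _ _ _ ⟨c, d, hc, rfl, rfl⟩ ⟨c', d', hc', rfl, h⟩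
  rw [Sum.inr.inj h] at hc
  rw [β.inj hc hc']

theorem BobHose.rightUnique : Relator.RightUnique (BobHose β) := by
  rintro _ _ _ ⟨c, d, hc, rfl, rfl⟩ ⟨c', d', hc', h, rfl⟩
  rw [Sum.inl.inj h, hc', Option.some_inj] at hc
  rw [hc]

theorem BobHose.not_of_left {u v w : C ⊕ C} (h : BobHose β u v) : ¬ BobHose β v w := by
  rintro ⟨c, -, -, rfl, -⟩
  obtain ⟨-, d, -, -, hd⟩ := h
  exact Sum.inl_ne_inr hd

end BobHose

variable [DecidableEq C]

section Flow

variable (a : C) (α β : C ≃. C)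

/-- Where the water arrives on Alice's side in position `c` of a relay started at `a`: at the tap if
`c = a`, and otherwise through the pipe `Sum.inr c`. A relay has two pipes for each position `c`, of
which `Sum.inl c` carries water from Alice to Bob and `Sum.inr c` from Bob to Alice. -/
def arrival (c : C) : Option (C ⊕ C) := if c = a then none else some (.inr c)

/-- Alice's hoses in a relay, directed along the water: they lead from position `c` to `α c`. -/
def AliceHose (u v : Option (C ⊕ C)) : Prop :=
  ∃ c d, α c = some d ∧ u = arrival a c ∧ v = some (.inl d)

/-- The edges of the graph of a relay game, hoses and pipes, directed along the water. -/
inductive Flow : Option (C ⊕ C) ⊕ (C ⊕ C) → Option (C ⊕ C) ⊕ (C ⊕ C) → Prop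
  | alice {u v : Option (C ⊕ C)} (h : AliceHose a α u v) : Flow (.inl u) (.inl v)
  | bob {u v : C ⊕ C} (h : BobHose β u v) : Flow (.inr u) (.inr v)
  | toBob (c : C) : Flow (.inl (some (.inl c))) (.inr (.inl c))
  | toAlice (c : C) : Flow (.inr (.inr c)) (.inl (some (.inr c)))

variable {a α β}

theorem arrival_self : arrival a a = none := if_pos rfl

theorem arrival_of_ne {c : C} (h : c ≠ a) : arrival a c = some (.inr c) := if_neg h

theorem arrival_injective : Function.Injective (arrival a) := by
  intro c d h
  unfold arrival at h
  split_ifs at h with hc hd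
  · exact hc.trans hd.symm
  · exact Sum.inr_injective (Option.some_injective _ h)

theorem arrival_ne_inl (c d : C) : arrival a c ≠ some (.inl d) := by
  unfold arrival
  split_ifs <;> simp

theorem AliceHose.leftUnique : Relator.LeftUnique (AliceHose a α) := by
  rintro _ _ _ ⟨c, d, hc, rfl, rfl⟩ ⟨c', d', hc', rfl, h⟩
  obtain rfl : d = d' := Sum.inl_injective (Option.some_injective _ h)
  rw [α.inj hc hc']

theorem AliceHose.rightUnique : Relator.RightUnique (AliceHose a α) := by
  rintro _ _ _ ⟨c, d, hc, rfl, rfl⟩ ⟨c', d', hc', h, rfl⟩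
  rw [arrival_injective h, hc', Option.some_inj] at hc
  rw [hc]

theorem AliceHose.not_of_left {u v w : Option (C ⊕ C)} (h : AliceHose a α u v) :
    ¬ AliceHose a α v w := by
  rintro ⟨c, -, -, hc, -⟩
  obtain ⟨-, d, -, -, rfl⟩ := h
  exact arrival_ne_inl c d hc.symm

theorem Flow.inl_inl_iff {u v : Option (C ⊕ C)} :
    Flow a α β (.inl u) (.inl v) ↔ AliceHose a α u v :=
  ⟨fun h => by cases h; assumption, .alice⟩

theorem Flow.inr_inr_iff {u v : C ⊕ C} : Flow a α β (.inr u) (.inr v) ↔ BobHose β u v :=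
  ⟨fun h => by cases h; assumption, .bob⟩

theorem Flow.inl_inr_or_inr_inl_iff {u : Option (C ⊕ C)} {v : C ⊕ C} :
    Flow a α β (.inl u) (.inr v) ∨ Flow a α β (.inr v) (.inl u) ↔ u = some v := by
  constructor
  · rintro (⟨⟨⟩⟩ | ⟨⟨⟩⟩) <;> rfl
  · rintro rfl
    cases v with
    | inl c => exact .inl (.toBob c)
    | inr c => exact .inr (.toAlice c)

theorem Flow.leftUnique : Relator.LeftUnique (Flow a α β) := by
  intro u v w hu hv
  cases hu with
  | alice h =>
    cases hv with
    | alice h' => exact congrArg Sum.inl (AliceHose.leftUnique h h')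
    | toAlice c => obtain ⟨_, _, _, _, ⟨⟩⟩ := h
  | bob h =>
    cases hv with
    | bob h' => exact congrArg Sum.inr (BobHose.leftUnique h h')
    | toBob c => obtain ⟨_, _, _, _, ⟨⟩⟩ := h
  | toBob c =>
    cases hv with
    | bob h => obtain ⟨_, _, _, _, ⟨⟩⟩ := h
    | toBob => rfl
  | toAlice c =>
    cases hv with
    | alice h => obtain ⟨_, _, _, _, ⟨⟩⟩ := h
    | toAlice => rfl

theorem Flow.not_to_tap (u : Option (C ⊕ C) ⊕ (C ⊕ C)) : ¬ Flow a α β u (.inl none) := by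
  rintro ⟨_, _, _, _, ⟨⟩⟩

theorem Flow.not_from_arrival {c : C} (hc : α c = none) (v : Option (C ⊕ C) ⊕ (C ⊕ C)) :
    ¬ Flow a α β (.inl (arrival a c)) v := by
  generalize hu : arrival a c = u
  rintro (⟨c', d, hd, rfl, -⟩ | _ | d)
  · rw [arrival_injective hu, hd] at hc
    exact Option.some_ne_none d hc
  · exact arrival_ne_inl c d hu

theorem Flow.not_from_bobEnd {c : C} (hc : β c = none) (v : Option (C ⊕ C) ⊕ (C ⊕ C)) :
    ¬ Flow a α β (.inr (.inl c)) v := by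
  rintro (_ | ⟨c', d, hd, ⟨⟩, -⟩)
  exact Option.some_ne_none d (hd.symm.trans hc)

theorem Flow.reflTransGen_bobEnd {c d : C} (hc : α c = some d) :
    ReflTransGen (Flow a α β) (.inl (arrival a c)) (.inr (.inl d)) :=
  .head (.alice ⟨c, d, hc, rfl, rfl⟩) (.single (.toBob d))

theorem Flow.reflTransGen_arrival_of_trans {c d : C} (h : α.trans β c = some d) (hd : d ≠ a) :
    ReflTransGen (Flow a α β) (.inl (arrival a c)) (.inl (arrival a d)) := by
  obtain ⟨e, hce, hed⟩ := (PEquiv.trans_eq_some _ _ _ _).1 h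
  rw [arrival_of_ne hd]
  exact (Flow.reflTransGen_bobEnd hce).trans
    (.head (.bob ⟨e, d, hed, rfl, rfl⟩) (.single (.toAlice d)))

/-- Only the last visit to `a` matters, so the pipe `Sum.inr a`, at the end of which Alice has no
hose, is never used. -/
theorem Flow.reflTransGen_arrival {c : C}
    (h : ReflTransGen (fun c d => α.trans β c = some d) a c) :
    ReflTransGen (Flow a α β) (.inl none) (.inl (arrival a c)) := by
  rw [← arrival_self (a := a)]
  exact ReflTransGen.lift' (fun c => Sum.inl (arrival a c))
    (fun _ _ h => Flow.reflTransGen_arrival_of_trans h.1 h.2) _ _ (reflTransGen_and_ne_source h)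

end Flow

variable [Finite C] {n : ℕ}

/-- The relay game: started at `a`, the position of the water is moved alternately by the partial
permutation `α x` of Alice and by the partial permutation `β y` of Bob, until the one whose turn it
is has no move; the water then comes out on that player's side. -/
noncomputable def relay (a : C) (α β : (Fin n → Bool) → C ≃. C) : GardenHoseGame n where
  size := Nat.card (C ⊕ C)
  alice x := (SimpleGraph.fromRel (AliceHose a (α x))).comap (Option.map (Finite.equivFin _).symm)
  bob y := (SimpleGraph.fromRel (BobHose (β y))).comap (Finite.equivFin _).symm
  alice_degree_le_one _ _ _ _ huv huw :=
    Option.map_injective (Equiv.injective _) (eq_of_fromRel_adj AliceHose.leftUnique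
      AliceHose.rightUnique (fun _ _ _ => AliceHose.not_of_left) huv huw)
  bob_degree_le_one _ _ _ _ huv huw :=
    Equiv.injective _ (eq_of_fromRel_adj BobHose.leftUnique BobHose.rightUnique
      (fun _ _ _ => BobHose.not_of_left) huv huw)

variable {a : C} {α β : (Fin n → Bool) → C ≃. C} {x y : Fin n → Bool}

variable (a α β) in
/-- The ends of the pipes of a relay game, labelled by positions. -/
noncomputable def relayVertex : Option (C ⊕ C) ⊕ (C ⊕ C) ≃ (relay a α β).Vertex :=
  (Finite.equivFin (C ⊕ C)).optionCongr.sumCongr (Finite.equivFin (C ⊕ C))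

theorem relay_graph_adj_iff (u v : Option (C ⊕ C) ⊕ (C ⊕ C)) :
    ((relay a α β).graph x y).Adj (relayVertex a α β u) (relayVertex a α β v) ↔
      Flow a (α x) (β y) u v ∨ Flow a (α x) (β y) v u := by
  set e := Finite.equivFin (C ⊕ C)
  rcases u with u | u <;> rcases v with v | v
  · change (SimpleGraph.fromRel (AliceHose a (α x))).Adj
      ((u.map e).map e.symm) ((v.map e).map e.symm) ↔ _
    simp only [Option.map_map, Equiv.symm_comp_self, Option.map_id, id,
      fromRel_adj_iff fun _ h => AliceHose.not_of_left h h, Flow.inl_inl_iff]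
  · rw [Flow.inl_inr_or_inr_inl_iff]
    exact (Option.map_injective e.injective).eq_iff (b := some v)
  · rw [or_comm, Flow.inl_inr_or_inr_inl_iff]
    exact (Option.map_injective e.injective).eq_iff (b := some u)
  · change (SimpleGraph.fromRel (BobHose (β y))).Adj (e.symm (e u)) (e.symm (e v)) ↔ _
    simp only [Equiv.symm_apply_apply, fromRel_adj_iff fun _ h => BobHose.not_of_left h h,
      Flow.inr_inr_iff]

theorem waterExitsAt_relayVertex {v : Option (C ⊕ C) ⊕ (C ⊕ C)}
    (hv : ReflTransGen (Flow a (α x) (β y)) (.inl none) v)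
    (hexit : ∀ w, ¬ Flow a (α x) (β y) v w) :
    (relay a α β).WaterExitsAt x y (relayVertex a α β v) := by
  set e := relayVertex a α β
  refine exists_isMaximalPath (R := fun u w => Flow a (α x) (β y) (e.symm u) (e.symm w))
    (fun u w => ?_) (fun u v w hu hv => ?_) (fun u => ?_) (fun w => ?_) ?_
  · simpa only [e, Equiv.apply_symm_apply] using
      relay_graph_adj_iff (a := a) (α := α) (β := β) (e.symm u) (e.symm w)
  · exact e.symm.injective (Flow.leftUnique hu hv)
  · exact Flow.not_to_tap _
  · simpa using hexit _
  · exact hv.lift e fun u w h => by simpa only [Function.onFun, Equiv.symm_apply_apply] using h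

theorem computes_relay {f : (Fin n → Bool) → (Fin n → Bool) → Bool}
    (h : ∀ x y, ∃ c, ReflTransGen (fun c d => (α x).trans (β y) c = some d) a c ∧
      (f x y = false → α x c = none) ∧ (f x y = true → ∃ d, α x c = some d ∧ β y d = none)) :
    (relay a α β).Computes f := by
  intro x y
  obtain ⟨c, hc, hfalse, htrue⟩ := h x y
  have harrival := Flow.reflTransGen_arrival hc
  cases hf : f x y with
  | false =>
    exact ⟨_, waterExitsAt_relayVertex harrival (Flow.not_from_arrival (hfalse hf)),
      fun _ => rfl, nofun⟩
  | true =>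
    obtain ⟨d, hcd, hd⟩ := htrue hf
    exact ⟨_, waterExitsAt_relayVertex (harrival.trans (Flow.reflTransGen_bobEnd hcd))
      (Flow.not_from_bobEnd hd), nofun, fun _ => rfl⟩

end Relay

end GardenHoseGame

theorem gardenHoseComplexity_le_of_relay {C : Type*} [Finite C] {n : ℕ}
    {f : (Fin n → Bool) → (Fin n → Bool) → Bool} (a : C) (α β : (Fin n → Bool) → C ≃. C)
    (h : ∀ x y, ∃ c, ReflTransGen (fun c d => (α x).trans (β y) c = some d) a c ∧
      (f x y = false → α x c = none) ∧ (f x y = true → ∃ d, α x c = some d ∧ β y d = none)) :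
    gardenHoseComplexity f ≤ ((2 * Nat.card C : ℕ) : ℕ∞) := by
  classical
  refine (iInf₂_le (GardenHoseGame.relay a α β) (GardenHoseGame.computes_relay h)).trans
    (Nat.cast_le.2 ?_)
  rw [two_mul, ← Nat.card_sum]
  exact le_rfl

/-! ### Tours around the graph of a partial function -/

section Tour

variable {V : Type*}

/-- The corners of the graph of a partial function `g` on `V`: `(v, none)` is the place at `v` where
the edge to `g v` leaves, and `(v, some u)` is the place at `v` where an edge from `u` would arrive.
Corners without an edge are kept, so that the type does not depend on `g`. -/
abbrev Corner (V : Type*) : Type _ := V × Option V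

/-- The tour turns around each vertex according to the permutation `σ`. -/
def turn (σ : Equiv.Perm (Option V)) : Equiv.Perm (Corner V) := (Equiv.refl V).prodCongr σ

variable [DecidableEq V]

/-- The involution of the corners that crosses the edges of the graph of `g`, in both directions;
corners without an edge are fixed. -/
def cross (g : V → Option V) : Corner V → Corner V
  | (v, none) => match g v with
    | some w => (w, some v)
    | none => (v, none)
  | (v, some u) => if g u = some v then (u, none) else (v, some u)

/-- One step of the tour around the graph of `g`: cross the edge, if there is one, and turn. The
tour stops at the outgoing corner of a vertex where `g` is undefined. -/
def TourStep (σ : Equiv.Perm (Option V)) (g : V → Option V) (p q : Corner V) : Prop :=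
  ¬ (p.2 = none ∧ g p.1 = none) ∧ q = turn σ (cross g p)

variable {σ : Equiv.Perm (Option V)} {g : V → Option V} {u v w : V}

theorem cross_none_of_eq_some (h : g v = some w) : cross g (v, none) = (w, some v) := by
  simp only [cross, h]

theorem cross_none_of_eq_none (h : g v = none) : cross g (v, none) = (v, none) := by
  simp only [cross, h]

theorem cross_some_of_eq (h : g u = some v) : cross g (v, some u) = (u, none) := if_pos h

theorem cross_some_of_ne (h : g u ≠ some v) : cross g (v, some u) = (v, some u) := if_neg h

theorem cross_involutive (g : V → Option V) : Function.Involutive (cross g) := by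
  rintro ⟨v, _ | u⟩
  · cases h : g v with
    | none => rw [cross_none_of_eq_none h, cross_none_of_eq_none h]
    | some w => rw [cross_none_of_eq_some h, cross_some_of_eq h]
  · by_cases h : g u = some v
    · rw [cross_some_of_eq h, cross_none_of_eq_some h]
    · rw [cross_some_of_ne h, cross_some_of_ne h]

theorem cross_cross_eq_cross_or {h : V → Option V} (hgh : ∀ v, g v = none ∨ h v = none)
    (p : Corner V) : cross h (cross g p) = cross (fun v => (g v).or (h v)) p := by
  obtain ⟨v, _ | u⟩ := p
  · cases hg : g v with
    | none => simp only [cross, hg, Option.none_or]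
    | some w =>
      have hh : h v = none := (hgh v).resolve_left (hg ▸ Option.some_ne_none w)
      simp [cross, hg, hh]
  · cases hg : g u with
    | none => simp [cross, hg]
    | some w =>
      have hh : h u = none := (hgh u).resolve_left (hg ▸ Option.some_ne_none w)
      by_cases hw : w = v <;> simp [cross, hg, hh, hw]

/-- The tour makes a detour around the subtree of every predecessor `u` of `v`, and comes back to
the corner of `u` at `v`. -/
theorem reflTransGen_tourStep_of_acc [Finite V] (hσ : σ.IsCycleOn Set.univ)
    (hv : Acc (fun u v => g u = some v) v) (s : Option V) :
    ReflTransGen (TourStep σ g) (v, s) (v, none) := by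
  induction hv generalizing s with
  | intro v _ ih =>
    obtain ⟨k, hk⟩ : ∃ k : ℕ, (σ ^ k) s = none :=
      hσ.exists_pow_eq' Set.finite_univ (Set.mem_univ s) (Set.mem_univ none)
    induction k generalizing s with
    | zero => exact hk ▸ .refl
    | succ k ihk =>
      rcases s with _ | u
      · exact .refl
      have hturn : ReflTransGen (TourStep σ g) (v, σ (some u)) (v, none) := ihk _ hk
      by_cases hu : g u = some v
      · have hdown : TourStep σ g (v, some u) (u, σ none) :=
          ⟨by simp, by rw [cross_some_of_eq hu]; rfl⟩
        have hup : TourStep σ g (u, none) (v, σ (some u)) :=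
          ⟨by simp [hu], by rw [cross_none_of_eq_some hu]; rfl⟩
        exact .head hdown ((ih u hu (σ none)).trans (.head hup hturn))
      · have hstay : TourStep σ g (v, some u) (v, σ (some u)) :=
          ⟨by simp, by rw [cross_some_of_ne hu]; rfl⟩
        exact .head hstay hturn

theorem reflTransGen_tourStep [Finite V] (hσ : σ.IsCycleOn Set.univ)
    (hvw : ReflTransGen (fun u v => g u = some v) v w) (hw : g w = none) :
    ReflTransGen (TourStep σ g) (v, none) (w, none) := by
  induction hvw using ReflTransGen.head_induction_on with
  | refl => exact .refl
  | @head u v huv hvw ih =>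
    have hacc : Acc (fun u v => g u = some v) v :=
      acc_of_reflTransGen (fun _ _ _ h h' => Option.some_injective _ (h.symm.trans h'))
        (fun v hv => Option.some_ne_none v (hv.symm.trans hw)) hvw
    have hstep : TourStep σ g (u, none) (v, σ (some u)) :=
      ⟨by simp [huv], by rw [cross_none_of_eq_some huv]; rfl⟩
    exact .head hstep ((reflTransGen_tourStep_of_acc hσ hacc _).trans ih)

end Tour

/-! ### Two-party programs -/

/-- What a two-party program does next: it halts with an output, or it passes to a vertex that
depends only on the input of Alice or only on the input of Bob. -/
inductive Instruction (X Y V : Type*)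
  | halt (b : Bool)
  | alice (next : X → V)
  | bob (next : Y → V)

/-- A deterministic branching program whose input is shared between Alice, who knows an element of
`X`, and Bob, who knows an element of `Y`. -/
structure TwoPartyProgram (X Y V : Type*) where
  start : V
  instruction : V → Instruction X Y V

namespace TwoPartyProgram

variable {X Y V : Type*} (P : TwoPartyProgram X Y V)

/-- The output at a vertex where the program halts. -/
def output (v : V) : Option Bool :=
  match P.instruction v with
  | .halt b => some b
  | _ => none

/-- The next vertex, where it is determined by Alice's input. -/
def aliceNext (x : X) (v : V) : Option V :=
  match P.instruction v with
  | .alice next => some (next x)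
  | _ => none

/-- The next vertex, where it is determined by Bob's input. -/
def bobNext (y : Y) (v : V) : Option V :=
  match P.instruction v with
  | .bob next => some (next y)
  | _ => none

/-- The next vertex, unless the program halts. -/
def next (x : X) (y : Y) (v : V) : Option V := (P.aliceNext x v).or (P.bobNext y v)

/-- On every input `x y` the program halts with output `f x y`. -/
def Computes (f : X → Y → Bool) : Prop :=
  ∀ x y, ∃ v, ReflTransGen (fun u v => P.next x y u = some v) P.start v ∧
    P.output v = some (f x y)

variable {P} {x : X} {y : Y} {v : V} {b : Bool}

theorem aliceNext_eq_none_or_bobNext_eq_none (x : X) (y : Y) (v : V) :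
    P.aliceNext x v = none ∨ P.bobNext y v = none := by
  unfold aliceNext bobNext
  cases P.instruction v <;> simp

theorem aliceNext_eq_none_of_output (h : P.output v = some b) : P.aliceNext x v = none := by
  unfold output at h
  unfold aliceNext
  cases hv : P.instruction v <;> simp_all

theorem next_eq_none_of_output (h : P.output v = some b) : P.next x y v = none := by
  unfold output at h
  unfold next aliceNext bobNext
  cases hv : P.instruction v <;> simp_all

variable (P)

variable [DecidableEq V]

/-- The corners where the tour around the graph of the program stops with output `b`. -/
def exits (b : Bool) : Set (Corner V) := {p | p.2 = none ∧ P.output p.1 = some b}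

instance (b : Bool) : DecidablePred (· ∈ P.exits b) := fun p =>
  inferInstanceAs (Decidable (p.2 = none ∧ P.output p.1 = some b))

/-- Alice's half of a step of the tour; she stops at the exits with output `false`. -/
def aliceMove (x : X) : Corner V ≃. Corner V :=
  (PEquiv.ofSet (P.exits false)ᶜ).trans (cross_involutive (P.aliceNext x)).toPerm.toPEquiv

/-- Bob's half of a step of the tour; he stops at the exits with output `true`. -/
def bobMove (σ : Equiv.Perm (Option V)) (y : Y) : Corner V ≃. Corner V :=
  (PEquiv.ofSet (P.exits true)ᶜ).trans
    ((cross_involutive (P.bobNext y)).toPerm.trans (turn σ)).toPEquiv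

variable {P} {p q : Corner V} {σ : Equiv.Perm (Option V)}

theorem aliceMove_of_mem (hp : p ∈ P.exits false) : P.aliceMove x p = none := by
  simp [aliceMove, PEquiv.trans, PEquiv.ofSet, hp]

theorem aliceMove_of_notMem (hp : p ∉ P.exits false) :
    P.aliceMove x p = some (cross (P.aliceNext x) p) := by
  simp [aliceMove, PEquiv.trans, PEquiv.ofSet, hp]

theorem bobMove_of_mem (hp : p ∈ P.exits true) : P.bobMove σ y p = none := by
  simp [bobMove, PEquiv.trans, PEquiv.ofSet, hp]

theorem bobMove_of_notMem (hp : p ∉ P.exits true) :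
    P.bobMove σ y p = some (turn σ (cross (P.bobNext y) p)) := by
  simp [bobMove, PEquiv.trans, PEquiv.ofSet, hp]

theorem cross_aliceNext_of_mem_exits (hp : p ∈ P.exits b) : cross (P.aliceNext x) p = p := by
  obtain ⟨v, s⟩ := p
  obtain ⟨rfl, hv⟩ := hp
  exact cross_none_of_eq_none (aliceNext_eq_none_of_output hv)

theorem aliceMove_trans_bobMove_of_tourStep (h : TourStep σ (P.next x y) p q) :
    (P.aliceMove x).trans (P.bobMove σ y) p = some q := by
  obtain ⟨hp, rfl⟩ := h
  have hexit (b : Bool) : p ∉ P.exits b := fun hb => hp ⟨hb.1, next_eq_none_of_output hb.2⟩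
  have hcross : cross (P.aliceNext x) p ∉ P.exits true := fun hc => by
    have hfix := cross_aliceNext_of_mem_exits (x := x) hc
    rw [cross_involutive] at hfix
    exact hexit true (hfix ▸ hc)
  refine (PEquiv.trans_eq_some _ _ _ _).2 ⟨_, aliceMove_of_notMem (hexit false), ?_⟩
  rw [bobMove_of_notMem hcross,
    cross_cross_eq_cross_or (aliceNext_eq_none_or_bobNext_eq_none x y)]
  rfl

end TwoPartyProgram

open TwoPartyProgram in
theorem gardenHoseComplexity_le_of_program {n : ℕ} {V : Type*} [Finite V]
    {f : (Fin n → Bool) → (Fin n → Bool) → Bool}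
    {P : TwoPartyProgram (Fin n → Bool) (Fin n → Bool) V} (h : P.Computes f) :
    gardenHoseComplexity f ≤ ((2 * (Nat.card V * (Nat.card V + 1)) : ℕ) : ℕ∞) := by
  classical
  obtain ⟨σ, hσ⟩ : ∃ σ : Equiv.Perm (Option V), σ.IsCycleOn Set.univ :=
    (Set.countable_univ.exists_cycleOn).imp fun _ h => h.1
  rw [← Finite.card_option, ← Nat.card_prod]
  refine gardenHoseComplexity_le_of_relay (P.start, none) P.aliceMove (P.bobMove σ) fun x y => ?_
  obtain ⟨v, hv, hout⟩ := h x y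
  have htour := ReflTransGen.mono (fun _ _ => aliceMove_trans_bobMove_of_tourStep) _ _
    (reflTransGen_tourStep hσ hv (next_eq_none_of_output hout))
  have hexit : (v, none) ∈ P.exits (f x y) := ⟨rfl, hout⟩
  refine ⟨(v, none), htour, fun hf => aliceMove_of_mem (hf ▸ hexit), fun hf => ⟨(v, none), ?_, ?_⟩⟩
  · rw [aliceMove_of_notMem (by simp [exits, hout, hf]), cross_aliceNext_of_mem_exits hexit]
  · exact bobMove_of_mem (hf ▸ hexit)

/-! ### Turing machines with bounded space -/

namespace OfflineTM

variable {M : OfflineTM} {w w' : List Bool} {N K n t : ℕ}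

section Step

theorem step_of_halted {c : M.Cfg} (h : c.state = M.accept ∨ c.state = M.reject) :
    M.step w c = c :=
  if_pos h

theorem step_congr {c : M.Cfg} (hlen : w.length = w'.length)
    (h : inputSymbol w c.inputHead = inputSymbol w' c.inputHead) : M.step w c = M.step w' c := by
  simp only [step, hlen, h]

theorem inputSymbol_append_of_le {u : List Bool} (v v' : List Bool) {p : ℕ} (hp : p ≤ u.length) :
    inputSymbol (u ++ v) p = inputSymbol (u ++ v') p := by
  cases p with
  | zero => rfl
  | succ p => simp only [inputSymbol, List.getElem?_append_left (Nat.lt_of_succ_le hp)]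

theorem inputSymbol_append_of_lt {u u' : List Bool} (v : List Bool) (hu : u.length = u'.length)
    {p : ℕ} (hp : u.length < p) : inputSymbol (u ++ v) p = inputSymbol (u' ++ v) p := by
  cases p with
  | zero => exact absurd hp (Nat.not_lt_zero _)
  | succ p =>
    simp only [inputSymbol, List.getElem?_append_right (Nat.le_of_lt_succ hp),
      List.getElem?_append_right (hu ▸ Nat.le_of_lt_succ hp), hu]

theorem inputHead_step_le {c : M.Cfg} (hc : c.inputHead ≤ w.length + 1) :
    (M.step w c).inputHead ≤ w.length + 1 := by
  unfold step
  split_ifs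
  · exact hc
  · dsimp only
    cases (M.trans _ _ _).2.1 <;> simp only [moveInput] <;> omega

theorem natAbs_workHead_step_sub_le (w : List Bool) (c : M.Cfg) (i : Fin M.tapes) :
    ((M.step w c).workHead i - c.workHead i).natAbs ≤ 1 := by
  unfold step
  split_ifs
  · simp
  · dsimp only
    cases ((M.trans _ _ _).2.2 i).2 <;> simp [moveWork]

theorem work_step_of_ne {c : M.Cfg} {i : Fin M.tapes} {z : ℤ} (hz : z ≠ c.workHead i) :
    (M.step w c).work i z = c.work i z := by
  unfold step
  split_ifs
  · rfl
  · exact Function.update_of_ne hz _ _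

end Step

section Run

theorem run_succ (w : List Bool) (t : ℕ) : M.run w (t + 1) = M.step w (M.run w t) :=
  Function.iterate_succ_apply' _ _ _

theorem inputHead_run_le (w : List Bool) (t : ℕ) : (M.run w t).inputHead ≤ w.length + 1 := by
  induction t with
  | zero => exact Nat.zero_le _
  | succ t ih => exact run_succ w t ▸ inputHead_step_le ih

theorem mem_visited_of_mem_uIcc {i : Fin M.tapes} {z : ℤ}
    (hz : z ∈ Set.uIcc 0 ((M.run w t).workHead i)) : (i, z) ∈ M.visited w := by
  induction t with
  | zero => exact ⟨0, by simpa [run, init, eq_comm] using hz⟩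
  | succ t ih =>
    by_cases h : (M.run w (t + 1)).workHead i = z
    · exact ⟨t + 1, h⟩
    · apply ih
      have hstep := natAbs_workHead_step_sub_le w (M.run w t) i
      rw [← run_succ] at hstep
      rw [Set.mem_uIcc] at hz ⊢
      omega

/-- The head has to pass all locations between `0` and `z`. -/
theorem natAbs_lt_ncard_visited {i : Fin M.tapes} {z : ℤ} (hfin : (M.visited w).Finite)
    (hz : (i, z) ∈ M.visited w) : z.natAbs < (M.visited w).ncard := by
  obtain ⟨t, rfl : (M.run w t).workHead i = z⟩ := hz
  set z := (M.run w t).workHead i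
  have hsub : Prod.mk i '' Set.uIcc 0 z ⊆ M.visited w := by
    rintro _ ⟨_, ha, rfl⟩
    exact mem_visited_of_mem_uIcc ha
  calc z.natAbs < (Prod.mk i '' Set.uIcc 0 z).ncard := by
        rw [Set.ncard_image_of_injective _ (Prod.mk_right_injective i), ← Finset.coe_uIcc,
          Set.ncard_coe_finset, Int.card_uIcc, sub_zero]
        exact Nat.lt_succ_self _
    _ ≤ (M.visited w).ncard := Set.ncard_le_ncard hsub hfin

theorem work_run_eq_blank {i : Fin M.tapes} {z : ℤ} (hz : (i, z) ∉ M.visited w) (t : ℕ) :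
    (M.run w t).work i z = M.blank := by
  induction t with
  | zero => rfl
  | succ t ih =>
    rw [run_succ, work_step_of_ne fun h => hz ⟨t, h.symm⟩]
    exact ih

end Run

section BoundedCfg

variable (M N K) in
/-- The configurations on input words of length `N` that use only the locations `-K, …, K` of the
work tapes. -/
def boundedCfg : Set M.Cfg :=
  {c | c.inputHead ≤ N + 1 ∧ (∀ i, (c.workHead i).natAbs ≤ K) ∧
    ∀ i z, K < z.natAbs → c.work i z = M.blank}

theorem init_mem_boundedCfg : M.init ∈ M.boundedCfg N K :=
  ⟨Nat.zero_le _, fun _ => Nat.zero_le _, fun _ _ _ => rfl⟩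

theorem run_mem_boundedCfg (hfin : (M.visited w).Finite) (hK : (M.visited w).ncard ≤ K) (t : ℕ) :
    M.run w t ∈ M.boundedCfg w.length K :=
  ⟨inputHead_run_le w t, fun _ => ((natAbs_lt_ncard_visited hfin ⟨t, rfl⟩).trans_le hK).le,
    fun _ _ hz => work_run_eq_blank
      (fun h => (hK.trans_lt hz).not_gt (natAbs_lt_ncard_visited hfin h)) t⟩

variable (M N K) in
/-- The finite data that determine a bounded configuration. -/
def boundedCfgCode (c : M.boundedCfg N K) :
    M.State × Fin (N + 2) × (Fin M.tapes → Finset.Icc (-(K : ℤ)) K) ×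
      (Fin M.tapes → Finset.Icc (-(K : ℤ)) K → M.Symbol) :=
  (c.1.state, ⟨c.1.inputHead, Nat.lt_succ_of_le c.2.1⟩,
    fun i => ⟨c.1.workHead i, by have := c.2.2.1 i; rw [Finset.mem_Icc]; omega⟩,
    fun i z => c.1.work i z)

theorem boundedCfgCode_injective : Function.Injective (M.boundedCfgCode N K) := by
  rintro ⟨⟨s, p, h, k⟩, hc⟩ ⟨⟨s', p', h', k'⟩, hc'⟩ heq
  simp only [boundedCfgCode, Prod.mk.injEq, Fin.mk.injEq] at heq
  obtain ⟨rfl, rfl, hh, hk⟩ := heq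
  obtain rfl : h = h' := funext fun i => congrArg Subtype.val (congrFun hh i)
  obtain rfl : k = k' := by
    funext i z
    by_cases hz : z ∈ Finset.Icc (-(K : ℤ)) K
    · exact congrFun (congrFun hk i) ⟨z, hz⟩
    · have hz' : K < z.natAbs := by rw [Finset.mem_Icc] at hz; omega
      exact (hc.2.2 i z hz').trans (hc'.2.2 i z hz').symm
  rfl

instance finite_boundedCfg : Finite (M.boundedCfg N K) :=
  have := M.stateFintype
  have := M.symbolFintype
  .of_injective _ boundedCfgCode_injective

theorem card_boundedCfg_le : Nat.card (M.boundedCfg N K) ≤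
    Nat.card M.State * ((N + 2) * ((2 * K + 1) ^ M.tapes *
      (Nat.card M.Symbol ^ (2 * K + 1)) ^ M.tapes)) := by
  have := M.stateFintype
  have := M.symbolFintype
  have hIcc : Nat.card (Finset.Icc (-(K : ℤ)) K) = 2 * K + 1 := by
    rw [Nat.card_eq_fintype_card, Fintype.card_coe, Int.card_Icc]
    omega
  refine (Nat.card_le_card_of_injective _ boundedCfgCode_injective).trans_eq ?_
  simp only [Nat.card_prod, Nat.card_fun, hIcc, Nat.card_fin]

end BoundedCfg

section Program

open Classical in
/-- The step of the machine among the bounded configurations; a configuration whose successor is not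
bounded is left unchanged. -/
noncomputable def boundedStep (w : List Bool) (c : M.boundedCfg N K) : M.boundedCfg N K :=
  if h : M.step w c ∈ M.boundedCfg N K then ⟨M.step w c, h⟩ else c

theorem boundedStep_congr {c : M.boundedCfg N K} (h : M.step w c = M.step w' c) :
    boundedStep w c = boundedStep w' c := by
  unfold boundedStep
  congr!

theorem boundedStep_of_mem {c : M.boundedCfg N K} (h : M.step w c ∈ M.boundedCfg N K) :
    boundedStep w c = ⟨M.step w c, h⟩ :=
  dif_pos h

open Classical in
/-- The machine on an input word shared between two parties, as a program on its bounded
configurations: Alice makes the steps in which the input head is on the left end marker or in the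
first half of the word, and Bob makes the others. The half that a player does not know is replaced
by zeros. -/
noncomputable def program (M : OfflineTM) (n K : ℕ) :
    TwoPartyProgram (Fin n → Bool) (Fin n → Bool) (M.boundedCfg (n + n) K) where
  start := ⟨M.init, init_mem_boundedCfg⟩
  instruction c :=
    if c.1.state = M.accept then .halt true
    else if c.1.state = M.reject then .halt false
    else if c.1.inputHead ≤ n then
      .alice fun x => boundedStep (List.ofFn x ++ List.replicate n false) c
    else .bob fun y => boundedStep (List.replicate n false ++ List.ofFn y) c

theorem output_program {c : M.boundedCfg (n + n) K} {b : Bool}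
    (h : c.1.state = if b = true then M.accept else M.reject) :
    (M.program n K).output c = some b := by
  cases b <;> simp_all [TwoPartyProgram.output, program, M.accept_ne_reject.symm]

theorem next_program {c : M.boundedCfg (n + n) K}
    (h : ¬ (c.1.state = M.accept ∨ c.1.state = M.reject)) (x y : Fin n → Bool) :
    (M.program n K).next x y c = some (boundedStep (List.ofFn x ++ List.ofFn y) c) := by
  obtain ⟨haccept, hreject⟩ := not_or.1 h
  by_cases hn : c.1.inputHead ≤ n
  · simp only [TwoPartyProgram.next, TwoPartyProgram.aliceNext, program, haccept, hreject, hn,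
      if_true, if_false, Option.some_or, Option.some_inj]
    exact boundedStep_congr
      (step_congr (by simp) (inputSymbol_append_of_le _ _ (by simpa using hn)))
  · simp only [TwoPartyProgram.next, TwoPartyProgram.aliceNext, TwoPartyProgram.bobNext, program,
      haccept, hreject, hn, if_false, Option.none_or, Option.some_inj]
    exact boundedStep_congr
      (step_congr (by simp) (inputSymbol_append_of_lt _ (by simp) (by simpa using hn)))

theorem reflTransGen_program {x y : Fin n → Bool}
    (hmem : ∀ t, M.run (List.ofFn x ++ List.ofFn y) t ∈ M.boundedCfg (n + n) K) (t : ℕ) :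
    ReflTransGen (fun c d => (M.program n K).next x y c = some d) (M.program n K).start
      ⟨M.run (List.ofFn x ++ List.ofFn y) t, hmem t⟩ := by
  induction t with
  | zero => exact .refl
  | succ t ih =>
    by_cases h : (M.run (List.ofFn x ++ List.ofFn y) t).state = M.accept ∨
        (M.run (List.ofFn x ++ List.ofFn y) t).state = M.reject
    · simpa only [run_succ, step_of_halted h] using ih
    · refine ih.tail ((next_program h x y).trans (congrArg some ?_))
      rw [boundedStep_of_mem (run_succ _ t ▸ hmem (t + 1))]
      simp only [run_succ]

theorem computes_program {f : (Fin n → Bool) → (Fin n → Bool) → Bool}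
    (hout : ∀ x y, M.Outputs (List.ofFn x ++ List.ofFn y) (f x y))
    (hfin : ∀ x y : Fin n → Bool, (M.visited (List.ofFn x ++ List.ofFn y)).Finite)
    (hK : ∀ x y : Fin n → Bool, (M.visited (List.ofFn x ++ List.ofFn y)).ncard ≤ K) :
    (M.program n K).Computes f := by
  intro x y
  have hmem (t : ℕ) : M.run (List.ofFn x ++ List.ofFn y) t ∈ M.boundedCfg (n + n) K := by
    simpa using run_mem_boundedCfg (hfin x y) (hK x y) t
  obtain ⟨t, ht⟩ := hout x y
  exact ⟨_, reflTransGen_program hmem t, output_program ht⟩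

end Program

end OfflineTM

/-! ### The polynomial bound -/

theorem gardenHoseComplexity_const_le (n : ℕ) (b : Bool) :
    gardenHoseComplexity (fun _ _ : Fin n → Bool => b) ≤ 4 := by
  let P : TwoPartyProgram (Fin n → Bool) (Fin n → Bool) Unit := ⟨(), fun _ => .halt b⟩
  have hP : P.Computes fun _ _ => b := fun _ _ => ⟨(), .refl, rfl⟩
  simpa using gardenHoseComplexity_le_of_program hP

theorem le_mul_clog_of_le_mul_logb {k m : ℕ} {c : ℝ} (h : (k : ℝ) ≤ c * Real.logb 2 m) :
    k ≤ ⌈c⌉₊ * Nat.clog 2 m := by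
  have hlog : 0 ≤ Real.logb 2 m := by
    rcases Nat.eq_zero_or_pos m with rfl | hm
    · simp
    · exact Real.logb_nonneg one_lt_two (mod_cast hm)
  rw [← Nat.cast_le (α := ℝ), Nat.cast_mul]
  refine h.trans (mul_le_mul (Nat.le_ceil c) ?_ hlog (Nat.cast_nonneg _))
  exact_mod_cast (Real.natCeil_logb_natCast 2 m) ▸ Nat.le_ceil (Real.logb 2 m)

theorem pow_clog_le_mul {b m : ℕ} (hb : 1 < b) (hm : m ≠ 0) : b ^ Nat.clog b m ≤ b * m := by
  rcases (Nat.one_le_iff_ne_zero.2 hm).eq_or_lt with rfl | hm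
  · simpa using hb.le
  · calc b ^ Nat.clog b m = b ^ ((Nat.clog b m).pred + 1) := by
          rw [← Nat.succ_eq_add_one, Nat.succ_pred_eq_of_pos (Nat.clog_pos hb hm)]
      _ = b * b ^ (Nat.clog b m).pred := pow_succ' _ _
      _ ≤ b * m := Nat.mul_le_mul_left b (Nat.pow_pred_clog_lt_self hb hm).le

namespace OfflineTM

theorem exists_polynomial_card_boundedCfg_le (M : OfflineTM) (d : ℕ) :
    ∃ p : Polynomial ℕ, ∀ m : ℕ, m ≠ 0 →
      Nat.card (M.boundedCfg m (d * Nat.clog 2 m)) ≤ p.eval m := by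
  set a := Nat.card M.Symbol
  refine ⟨.C (Nat.card M.State) * ((.X + 2) * ((2 * (.C d * (2 * .X)) + 1) ^ M.tapes *
    (.C (2 ^ a) * (2 * .X) ^ (2 * a * d)) ^ M.tapes)), fun m hm => ?_⟩
  have hpow : 2 ^ Nat.clog 2 m ≤ 2 * m := pow_clog_le_mul one_lt_two hm
  have hlog : Nat.clog 2 m ≤ 2 * m := Nat.lt_two_pow_self.le.trans hpow
  have htape : a ^ (2 * (d * Nat.clog 2 m) + 1) ≤ 2 ^ a * (2 * m) ^ (2 * a * d) :=
    calc a ^ (2 * (d * Nat.clog 2 m) + 1)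
        ≤ (2 ^ a) ^ (2 * (d * Nat.clog 2 m) + 1) := by gcongr; exact Nat.lt_two_pow_self.le
      _ = 2 ^ a * (2 ^ Nat.clog 2 m) ^ (2 * a * d) := by ring
      _ ≤ 2 ^ a * (2 * m) ^ (2 * a * d) := by gcongr
  refine card_boundedCfg_le.trans ?_
  simp only [Polynomial.eval_mul, Polynomial.eval_add, Polynomial.eval_pow, Polynomial.eval_C,
    Polynomial.eval_X, Polynomial.eval_ofNat, Polynomial.eval_one]
  gcongr

end OfflineTM

/-- The garden-hose complexity of a log-space computable function is polynomial in `n`. -/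
theorem mainTheorem1 (f : ∀ n : ℕ, (Fin n → Bool) → (Fin n → Bool) → Bool)
    (hf : LogSpaceComputable f) :
    ∃ p : Polynomial ℕ, ∀ n : ℕ, gardenHoseComplexity (f n) ≤ ((p.eval n : ℕ) : ℕ∞) := by
  obtain ⟨M, c, hM⟩ := hf
  obtain ⟨q, hq⟩ := M.exists_polynomial_card_boundedCfg_le ⌈c⌉₊
  let p := q.comp (2 * .X)
  refine ⟨2 * (p * (p + 1)) + 4, fun n => ?_⟩
  rcases Nat.eq_zero_or_pos n with rfl | hn
  · obtain ⟨b, hb⟩ : ∃ b, f 0 = fun _ _ => b :=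
      ⟨f 0 0 0, funext₂ fun x y => by rw [Subsingleton.elim x, Subsingleton.elim y]⟩
    rw [hb]
    refine (gardenHoseComplexity_const_le 0 b).trans (mod_cast ?_)
    simp
  · have hspace (x y : Fin n → Bool) :
        (M.visited (List.ofFn x ++ List.ofFn y)).ncard ≤ ⌈c⌉₊ * Nat.clog 2 (n + n) :=
      le_mul_clog_of_le_mul_logb (by simpa [two_mul] using (hM n hn x y).2.2)
    have hprogram := OfflineTM.computes_program (fun x y => (hM n hn x y).1)
      (fun x y => (hM n hn x y).2.1) hspace
    have hcard : Nat.card (M.boundedCfg (n + n) (⌈c⌉₊ * Nat.clog 2 (n + n))) ≤ p.eval n := by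
      simpa [p, two_mul] using hq (n + n) (by omega)
    refine (gardenHoseComplexity_le_of_program hprogram).trans (Nat.cast_le.2 ?_)
    simp only [Polynomial.eval_add, Polynomial.eval_mul, Polynomial.eval_ofNat, Polynomial.eval_one]
    exact Nat.le_add_right_of_le (by gcongr)
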